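/- Let $q$ be a prime power, $\mathbb{F}_q$ a field with $q$ elements, $A=\mathbb{F}_q[t]$, $K=\mathbb{F}_q(t)$, and let $K_\infty=\mathbb{F}_q((1/t))$ be the completion of $K$ at its infinite place. For integers $d\ge 0$ and $n\ge 1$ put $S_d(n)=\sum_{a} 1/a^{n}\in K$, the sum over the monic $a\in A$ of degree $d$, and for positive integers $a,b$ let $$\zeta(a,b)=\sum_{d=0}^{\infty} S_d(a)\sum_{i=0}^{d-1}S_i(b)\in K_\infty .$$ Let $1\le s_1<q$ and $1\le s_2\le q$ be integers, let $k$ be an integer, and let $0\le k_i<k$ $(1\le i\le s_1)$ and $0\le l_j<k$ $(1\le j\le s_2)$ be integers. Put $a=q^k-\sum_{i=1}^{s_1}q^{k_i}$ and $b=s_2q^k-\sum_{j=1}^{s_2}q^{l_j}$. Choose $s_1$ entries of the list $k_1,\dots,k_{s_1},l_1,\dots,l_{s_2}$, say $k_1',\dots,k_{s_1}'$, and let $l_1',\dots,l_{s_2}'$ be the remaining entries. Put $a'=q^k-\sum_{i=1}^{s_1}q^{k_i'}$ and $b'=s_2q^k-\sum_{j=1}^{s_2}q^{l_j'}$. Then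 the series $\zeta(a,b)$ and $\zeta(a',b')$ converge in $K_\infty$, $\zeta(a',b')\neq 0$, and the ratio $\zeta(a,b)/\zeta(a',b')$ is rational, i.e. it lies in $\mathbb{F}_q(t)$. -/

import Mathlib

open Polynomial RatFunc

noncomputable section

/-- `A_{d+}`: the monic polynomials of degree `d` in `F[t]`. -/
def monicsOfDegree (F : Type*) [Field F] (d : ℕ) : Set F[X] :=
  {a | a.Monic ∧ a.natDegree = d}

/-- Over a finite field there are only finitely many monic polynomials of degree `d`. -/
theorem monicsOfDegree_finite (F : Type*) [Field F] [Finite F] (d : ℕ) :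
    (monicsOfDegree F d).Finite := by
  have : Finite (degreeLT F (d + 1)) :=
    Finite.of_equiv _ (degreeLTEquiv F (d + 1)).toEquiv.symm
  refine Set.Finite.subset (Set.toFinite ((degreeLT F (d + 1) : Submodule F F[X]) : Set F[X])) ?_
  rintro a ⟨-, ha⟩
  rw [SetLike.mem_coe, mem_degreeLT]
  exact lt_of_le_of_lt degree_le_natDegree (by rw [ha]; exact_mod_cast Nat.lt_succ_self d)

/-- The power sum `S_d(k)`, the sum of `1 / a ^ k` over the monic `a` of degree `d`, an element
of `F(t)`. -/
def powerSum (F : Type*) [Field F] [Finite F] (d k : ℕ) : RatFunc F :=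
  ∑ a ∈ (monicsOfDegree_finite F d).toFinset, 1 / (algebraMap F[X] (RatFunc F) a) ^ k

/-- `S_{<d}(k)`, the sum of `S_i(k)` over `0 ≤ i < d`. -/
def powerSumLT (F : Type*) [Field F] [Finite F] (d k : ℕ) : RatFunc F :=
  ∑ i ∈ Finset.range d, powerSum F i k

/-- The iterated power sum of depth two, `S_d(a, b) = S_d(a) * S_{<d}(b)`. -/
def iteratedPowerSum (F : Type*) [Field F] [Finite F] (d a b : ℕ) : RatFunc F :=
  powerSum F d a * powerSumLT F d b

/-- The terms `S_d(a, b)` of the series `ζ(a, b)`, seen in `K_∞`, the completion of `F(t)` at its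
infinite place. -/
def multizetaTerm (F : Type*) [Field F] [Finite F] [DecidableEq (RatFunc F)] (a b d : ℕ) :
    CompletionAtInfty F :=
  algebraMap (RatFunc F) (CompletionAtInfty F) (iteratedPowerSum F d a b)

/-- The multizeta value of depth two, `ζ(a, b) = ∑_{d ≥ 0} S_d(a, b)` in `K_∞`. -/
def multizeta (F : Type*) [Field F] [Finite F] [DecidableEq (RatFunc F)] (a b : ℕ) :
    CompletionAtInfty F :=
  ∑' d : ℕ, multizetaTerm F a b d

end

/-!
Let `m = q ^ k - ∑ i, q ^ κ i` and `n = s₂ * q ^ k - ∑ j, q ^ l j` be the two exponents, `x` the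
variable of the rational function field, and `θ = x ^ q ^ k`. As a polynomial `a` over `F` satisfies
`a(x) ^ q ^ j = a(x ^ q ^ j)`, the summands of `S_d(m)` and `S_{<d}(n)` are
`(∏ i, a(x ^ q ^ κ i)) / a(θ)` and `∏ j, (a(x ^ q ^ l j) / a(θ))`. Sums of such expressions, with
arbitrary evaluation points `t_i` in place of the powers of `x`, have product formulas:

* over monic `a` of degree `d`, with fewer than `q` points,
  `∑ a, (∏ i, a(t_i)) / a(θ) = ℓ_d⁻¹ * ∏ i, b_d(t_i)`;
* over monic `a` of degree less than `d`, for `d ≥ 1`, with at most `q` points,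
  `∑ a, ∏ i, (a(t_i) / a(θ)) = ∏ i, b_d(t_i) / (ℓ_{d-1} * (t_i - θ))`,

where `b_d(t) = ∏ j < d, (t - θ ^ q ^ j)` and `ℓ_d = ∏ 1 ≤ j ≤ d, (θ - θ ^ q ^ j)`. These are
`sum_monicsOfDegree_prod_aeval_div` and `sum_range_sum_monicsOfDegree_prod_aeval_div`. For their
proof, Lagrange interpolation at the nodes `θ ^ q ^ j`, where `a` takes the values `a(θ) ^ q ^ j`,
turns each `a(t_i)` into a polynomial in `a(θ)`. The elements `a(θ)`, for `a` monic of degree `d` or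
for `a` of degree less than `d`, are the zeros of `E_d - 1` and of `E_d`, where `E_d` is the Carlitz
polynomial, whose derivative is constant. Lagrange interpolation at these zeros therefore has equal
weights, and it evaluates the sum of a polynomial in `a(θ)` of small degree
(`sum_eval_aeval_eq_zero`, `sum_eval_aeval_div`).

It follows that `S_d(m) * S_{<d}(n) * ∏ j, (x ^ q ^ l j - θ)` is a function of the combined list
`κ, l` which is invariant under permutations (`iteratedPowerSum_mul_prod`). The two series are thus
proportional term by term, with ratio `∏ j, (x ^ q ^ l' j - θ) / ∏ j, (x ^ q ^ l j - θ)`. The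
explicit terms also show that from `d = 1` on each term is strictly smaller than the one before
(`inftyValuation_symmetricTerm_succ_le`), so the series converge and their first nonzero term
dominates, which makes the sums nonzero.
-/

noncomputable section

namespace Polynomial

/-! ### Frobenius nodes and the Carlitz polynomials -/

section PowerSums

variable {F L : Type*} [Field F] [Finite F] [Field L] [Algebra F L]

/-- Since `a` has coefficients in `F`, its values at `x, x ^ q, x ^ q ^ 2, …` are the iterated
`q`-th powers of its value at `x`. -/
theorem aeval_pow_natCard_pow (x : L) (a : F[X]) (j : ℕ) :
    aeval (x ^ Nat.card F ^ j) a = aeval x a ^ Nat.card F ^ j := by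
  cases nonempty_fintype F
  induction j with
  | zero => simp
  | succ j ih =>
    have h := Polynomial.aeval_algHom_apply (FiniteField.frobeniusAlgHom F L)
      (x ^ Nat.card F ^ j) a
    rw [FiniteField.coe_frobeniusAlgHom, ih] at h
    simpa only [Nat.card_eq_fintype_card, pow_succ, pow_mul] using h

theorem natCast_natCard_pow_eq_zero {j : ℕ} (hj : j ≠ 0) : ((Nat.card F ^ j : ℕ) : L) = 0 := by
  cases nonempty_fintype F
  have h : ((Fintype.card F : ℕ) : F) = 0 := FiniteField.cast_card_eq_zero F
  rw [Nat.cast_pow, Nat.card_eq_fintype_card, ← map_natCast (algebraMap F L), h, map_zero,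
    zero_pow hj]

theorem pow_natCard_pow_injective {θ : L} (hθ : Transcendental F θ) :
    Function.Injective fun j : ℕ => θ ^ Nat.card F ^ j := by
  intro i j hij
  have h : (X : F[X]) ^ Nat.card F ^ i = X ^ Nat.card F ^ j :=
    transcendental_iff_injective.mp hθ (by simpa using hij)
  have h' := congrArg natDegree h
  rw [natDegree_X_pow, natDegree_X_pow] at h'
  exact Nat.pow_right_injective Finite.one_lt_card h'

/-- The weight of the node `θ ^ q ^ j` in Lagrange interpolation at the `d + 1` nodes
`θ, θ ^ q, …, θ ^ q ^ d`. -/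
def frobeniusWeight (F : Type*) {L : Type*} [Field L] (θ : L) (d j : ℕ) : L :=
  Lagrange.nodalWeight (Finset.range (d + 1)) (fun j => θ ^ Nat.card F ^ j) j

theorem frobeniusWeight_ne_zero {θ : L} (hθ : Transcendental F θ) {d j : ℕ} (hj : j ≤ d) :
    frobeniusWeight F θ d j ≠ 0 :=
  Lagrange.nodalWeight_ne_zero (pow_natCard_pow_injective hθ).injOn
    (Finset.mem_range.2 (Nat.lt_succ_of_le hj))

theorem frobeniusWeight_zero (F : Type*) {L : Type*} [Field L] (θ : L) (d : ℕ) :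
    frobeniusWeight F θ d 0 = (∏ j ∈ Finset.range d, (θ - θ ^ Nat.card F ^ (j + 1)))⁻¹ := by
  have h : (Finset.range (d + 1)).erase 0 = (Finset.range d).image (· + 1) := by
    ext j
    cases j <;> simp
  rw [frobeniusWeight, Lagrange.nodalWeight, h, Finset.prod_image (by simp),
    Finset.prod_inv_distrib]
  simp

/-- The leading coefficient of the interpolation polynomial of `a` at `θ, θ ^ q, …, θ ^ q ^ d`. -/
theorem algebraMap_coeff_eq_sum_frobeniusWeight {θ : L} (hθ : Transcendental F θ) {d : ℕ}
    {a : F[X]} (ha : a.degree < (d + 1 : ℕ)) :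
    algebraMap F L (a.coeff d) =
      ∑ j ∈ Finset.range (d + 1), frobeniusWeight F θ d j * aeval θ a ^ Nat.card F ^ j := by
  have h := Lagrange.coeff_eq_sum (s := Finset.range (d + 1))
    (v := fun j => θ ^ Nat.card F ^ j) (P := a.map (algebraMap F L))
    (pow_natCard_pow_injective hθ).injOn (by simpa using ha)
  rw [Finset.card_range, Nat.add_sub_cancel, coeff_map] at h
  rw [h]
  refine Finset.sum_congr rfl fun j _ => ?_
  rw [eval_map_algebraMap, aeval_pow_natCard_pow, frobeniusWeight, Lagrange.nodalWeight,
    Finset.prod_inv_distrib, div_eq_inv_mul]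

/-- The Carlitz polynomial `E_d`, the `F`-linear polynomial over `L` of degree `q ^ d` whose value
at `a(θ)`, for `a ∈ F[t]` of degree at most `d`, is the coefficient of `t ^ d` in `a`. -/
def carlitzPoly (F : Type*) {L : Type*} [Field L] (θ : L) (d : ℕ) : L[X] :=
  ∑ j ∈ Finset.range (d + 1), C (frobeniusWeight F θ d j) * X ^ Nat.card F ^ j

theorem eval_carlitzPoly_aeval {θ : L} (hθ : Transcendental F θ) {d : ℕ} {a : F[X]}
    (ha : a.degree < (d + 1 : ℕ)) :
    (carlitzPoly F θ d).eval (aeval θ a) = algebraMap F L (a.coeff d) := by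
  rw [algebraMap_coeff_eq_sum_frobeniusWeight hθ ha, carlitzPoly, eval_finsetSum]
  simp

theorem eval_zero_carlitzPoly {F L : Type*} [Field F] [Finite F] [Field L] (θ : L) (d : ℕ) :
    (carlitzPoly F θ d).eval 0 = 0 := by
  rw [carlitzPoly, eval_finsetSum]
  exact Finset.sum_eq_zero fun j _ => by simp [Nat.card_pos.ne']

/-- All exponents of `E_d` except `1` are divisible by the characteristic. -/
theorem derivative_carlitzPoly (θ : L) (d : ℕ) :
    derivative (carlitzPoly F θ d) = C (frobeniusWeight F θ d 0) := by
  rw [carlitzPoly, derivative_sum, Finset.sum_range_succ', Finset.sum_eq_zero]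
  · simp
  · intro j _
    rw [derivative_C_mul_X_pow, natCast_natCard_pow_eq_zero j.succ_ne_zero, mul_zero, map_zero,
      zero_mul]

theorem degree_carlitzPoly_sub_lt {F L : Type*} [Field F] [Finite F] [Field L] (θ : L) (d : ℕ) :
    (carlitzPoly F θ d - C (frobeniusWeight F θ d d) * X ^ Nat.card F ^ d).degree <
      ((Nat.card F ^ d : ℕ) : WithBot ℕ) := by
  rw [carlitzPoly, Finset.sum_range_succ, add_sub_cancel_right]
  refine (degree_sum_le _ _).trans_lt ((Finset.sup_lt_iff (WithBot.bot_lt_coe _)).2 fun j hj => ?_)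
  refine (degree_C_mul_X_pow_le _ _).trans_lt (Nat.cast_lt.2 ?_)
  exact Nat.pow_lt_pow_right Finite.one_lt_card (Finset.mem_range.1 hj)

/-! ### Sums over level sets of the Carlitz polynomials -/

/-- Since `E_d` has degree `q ^ d`, a level set of `E_d` with `q ^ d` elements determines it up to
a constant. -/
theorem carlitzPoly_sub_C_eq_nodal {θ : L} (hθ : Transcendental F θ) {d : ℕ} {s : Finset F[X]}
    (hs : s.card = Nat.card F ^ d) {c : L}
    (hc : ∀ a ∈ s, (carlitzPoly F θ d).eval (aeval θ a) = c) :
    carlitzPoly F θ d - C c =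
      C (frobeniusWeight F θ d d) * Lagrange.nodal s fun a => aeval θ a := by
  have hinj : Set.InjOn (fun a : F[X] => aeval θ a) s :=
    (transcendental_iff_injective.mp hθ).injOn
  have hpos : 0 < Nat.card F ^ d := pow_pos Nat.card_pos d
  refine Polynomial.eq_of_degree_sub_lt_of_eval_index_eq s hinj ?_ fun a ha => ?_
  -- both sides have the leading term `frobeniusWeight F θ d d * X ^ q ^ d`
  · rw [hs]
    have h : carlitzPoly F θ d - C c - C (frobeniusWeight F θ d d) *
          Lagrange.nodal s (fun a => aeval θ a) =
        (carlitzPoly F θ d - C (frobeniusWeight F θ d d) * X ^ Nat.card F ^ d) - C c -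
          C (frobeniusWeight F θ d d) *
            (Lagrange.nodal s (fun a => aeval θ a) - X ^ Nat.card F ^ d) := by ring
    rw [h]
    refine (degree_sub_le _ _).trans_lt (max_lt ((degree_sub_le _ _).trans_lt (max_lt
      (degree_carlitzPoly_sub_lt θ d) (degree_C_le.trans_lt (Nat.cast_pos.2 hpos)))) ?_)
    rw [degree_C_mul (frobeniusWeight_ne_zero hθ le_rfl)]
    have hn := Lagrange.degree_nodal (s := s) (v := fun a : F[X] => aeval θ a)
    rw [hs] at hn
    have := degree_sub_lt_left (p := Lagrange.nodal s (fun a : F[X] => aeval θ a))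
      (q := X ^ Nat.card F ^ d) (by rw [hn, degree_X_pow]) Lagrange.nodal_ne_zero
      (by rw [Lagrange.nodal_monic.leadingCoeff, (monic_X_pow _).leadingCoeff])
    rwa [hn] at this
  · rw [eval_sub, eval_C, hc a ha, sub_self, eval_mul, Lagrange.eval_nodal_at_node ha, mul_zero]

/-- As the derivative of `E_d` is constant, all elements of a full level set of `E_d` have the same
weight. -/
theorem nodalWeight_aeval_eq [DecidableEq F[X]] {θ : L} (hθ : Transcendental F θ) {d : ℕ}
    {s : Finset F[X]} (hs : s.card = Nat.card F ^ d) {c : L}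
    (hc : ∀ a ∈ s, (carlitzPoly F θ d).eval (aeval θ a) = c) {a : F[X]} (ha : a ∈ s) :
    Lagrange.nodalWeight s (fun a => aeval θ a) a =
      frobeniusWeight F θ d d / frobeniusWeight F θ d 0 := by
  have h := congrArg derivative (carlitzPoly_sub_C_eq_nodal hθ hs hc)
  rw [derivative_sub, derivative_C, sub_zero, derivative_carlitzPoly, derivative_C_mul] at h
  have h' := congrArg (eval (aeval θ a)) h
  rw [eval_C, eval_mul, eval_C] at h'
  rw [Lagrange.nodalWeight_eq_eval_derivative_nodal ha, h', div_mul_eq_div_div,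
    div_self (frobeniusWeight_ne_zero hθ le_rfl), one_div]

/-- Power sums of small exponent over a full level set of `E_d` vanish. -/
theorem sum_eval_aeval_eq_zero {θ : L} (hθ : Transcendental F θ) {d : ℕ} {s : Finset F[X]}
    (hs : s.card = Nat.card F ^ d) {c : L}
    (hc : ∀ a ∈ s, (carlitzPoly F θ d).eval (aeval θ a) = c) {g : L[X]}
    (hg : g.natDegree + 1 < Nat.card F ^ d) : ∑ a ∈ s, g.eval (aeval θ a) = 0 := by
  classical
  have hinj : Set.InjOn (fun a : F[X] => aeval θ a) s :=
    (transcendental_iff_injective.mp hθ).injOn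
  have h := Lagrange.coeff_eq_sum hinj (P := g)
    (degree_le_natDegree.trans_lt (Nat.cast_lt.2 (by omega)))
  rw [hs, coeff_eq_zero_of_natDegree_lt (by omega)] at h
  have h' : ∀ a ∈ s, g.eval (aeval θ a) / ∏ b ∈ s.erase a, (aeval θ a - aeval θ b) =
      g.eval (aeval θ a) * (frobeniusWeight F θ d d / frobeniusWeight F θ d 0) := fun a ha => by
    rw [← nodalWeight_aeval_eq hθ hs hc ha, Lagrange.nodalWeight, Finset.prod_inv_distrib,
      div_eq_mul_inv]
  rw [Finset.sum_congr rfl h', ← Finset.sum_mul] at h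
  exact (mul_eq_zero.1 h.symm).resolve_right
    (div_ne_zero (frobeniusWeight_ne_zero hθ le_rfl) (frobeniusWeight_ne_zero hθ d.zero_le))

/-- Lagrange interpolation at a full level set of `E_d`, evaluated at `0`. -/
theorem sum_eval_aeval_div {θ : L} (hθ : Transcendental F θ) {d : ℕ} {s : Finset F[X]}
    (hs : s.card = Nat.card F ^ d)
    (hc : ∀ a ∈ s, (carlitzPoly F θ d).eval (aeval θ a) = 1) {g : L[X]}
    (hg : g.natDegree < Nat.card F ^ d) :
    ∑ a ∈ s, g.eval (aeval θ a) / aeval θ a = frobeniusWeight F θ d 0 * g.eval 0 := by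
  classical
  have hinj : Set.InjOn (fun a : F[X] => aeval θ a) s :=
    (transcendental_iff_injective.mp hθ).injOn
  have hd := frobeniusWeight_ne_zero hθ (le_refl d)
  have h0 := frobeniusWeight_ne_zero hθ d.zero_le
  have hne : ∀ a ∈ s, 0 ≠ aeval θ a := fun a ha h => by
    have := hc a ha
    rw [← h, eval_zero_carlitzPoly] at this
    exact zero_ne_one this
  have hnodal : (Lagrange.nodal s fun a : F[X] => aeval θ a).eval 0 =
      -(frobeniusWeight F θ d d)⁻¹ := by
    have h := congrArg (eval 0) (carlitzPoly_sub_C_eq_nodal hθ hs hc)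
    rw [eval_sub, eval_zero_carlitzPoly, eval_C, zero_sub, eval_mul, eval_C] at h
    rw [eq_neg_iff_add_eq_zero]
    field_simp
    linear_combination -h
  have h := congrArg (eval 0) (Lagrange.eq_interpolate hinj (f := g)
    (degree_le_natDegree.trans_lt (Nat.cast_lt.2 (by omega))))
  rw [Lagrange.eval_interpolate_not_at_node _ hne, hnodal,
    Finset.sum_congr rfl fun a ha => by rw [nodalWeight_aeval_eq hθ hs hc ha]] at h
  rw [h, Finset.mul_sum, Finset.mul_sum]
  refine Finset.sum_congr rfl fun a ha => ?_
  have := (hne a ha).symm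
  rw [zero_sub]
  field_simp

end PowerSums

end Polynomial

namespace Polynomial

/-! ### Interpolation of `a(t)` from the conjugates of `a(θ)` -/

section ProductFormulas

variable {F L : Type*} [Field F] [Finite F] [Field L] [Algebra F L]

/-- For `a` of degree less than `d`, the polynomial in `x` whose value at `x = a(θ) ≠ 0` is
`a(t) / a(θ)`, obtained from Lagrange interpolation of `a` at the `d` nodes
`θ, θ ^ q, …, θ ^ q ^ (d - 1)`, where `a` takes the values `a(θ), a(θ) ^ q, …,
a(θ) ^ q ^ (d - 1)`. -/
def ratioPoly (F : Type*) {L : Type*} [Field L] (θ : L) (d : ℕ) (t : L) : L[X] :=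
  ∑ j ∈ Finset.range d,
    C ((Lagrange.basis (Finset.range d) (fun j => θ ^ Nat.card F ^ j) j).eval t) *
      X ^ (Nat.card F ^ j - 1)

theorem natDegree_ratioPoly_le {F L : Type*} [Field F] [Finite F] [Field L] (θ : L) (d : ℕ)
    (t : L) : (ratioPoly F θ d t).natDegree ≤ Nat.card F ^ (d - 1) - 1 := by
  refine natDegree_sum_le_of_forall_le _ _ fun j hj => (natDegree_C_mul_X_pow_le _ _).trans ?_
  have hj := Finset.mem_range.1 hj
  exact Nat.sub_le_sub_right (Nat.pow_le_pow_right Nat.card_pos (by omega)) 1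

theorem eval_zero_ratioPoly {F L : Type*} [Field F] [Finite F] [Field L] (θ : L) (d : ℕ) (t : L) :
    (ratioPoly F θ (d + 1) t).eval 0 =
      ∏ j ∈ Finset.range d, (t - θ ^ Nat.card F ^ (j + 1)) / (θ - θ ^ Nat.card F ^ (j + 1)) := by
  have h : (Finset.range (d + 1)).erase 0 = (Finset.range d).image (· + 1) := by
    ext j
    cases j <;> simp
  rw [ratioPoly, eval_finsetSum, Finset.sum_range_succ', Finset.sum_eq_zero]
  · rw [Lagrange.basis, h, Finset.prod_image (by simp), eval_mul, eval_C, eval_prod]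
    simp [Lagrange.basisDivisor, div_eq_inv_mul]
  · intro j _
    have : Nat.card F ^ (j + 1) - 1 ≠ 0 :=
      Nat.sub_ne_zero_of_lt (Nat.one_lt_pow j.succ_ne_zero Finite.one_lt_card)
    simp [this]

theorem mul_eval_ratioPoly {F L : Type*} [Field F] [Finite F] [Field L] (θ : L) (d : ℕ) (t x : L) :
    x * (ratioPoly F θ d t).eval x = ∑ j ∈ Finset.range d, x ^ Nat.card F ^ j *
      (Lagrange.basis (Finset.range d) (fun j => θ ^ Nat.card F ^ j) j).eval t := by
  rw [ratioPoly, eval_finsetSum, Finset.mul_sum]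
  refine Finset.sum_congr rfl fun j _ => ?_
  have hpos : 0 < Nat.card F ^ j := pow_pos Nat.card_pos j
  rw [eval_mul, eval_C, eval_pow, eval_X, mul_left_comm, ← pow_succ', Nat.sub_add_cancel hpos,
    mul_comm]

theorem aeval_eq_mul_eval_ratioPoly {θ : L} (hθ : Transcendental F θ) {d : ℕ} {a : F[X]}
    (ha : a.degree < d) (t : L) :
    aeval t a = aeval θ a * (ratioPoly F θ d t).eval (aeval θ a) := by
  have h := congrArg (eval t) (Lagrange.eq_interpolate (s := Finset.range d)
    (v := fun j => θ ^ Nat.card F ^ j) (f := a.map (algebraMap F L))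
    (pow_natCard_pow_injective hθ).injOn (by simpa using ha))
  rw [eval_map_algebraMap, Lagrange.interpolate_apply, eval_finsetSum] at h
  rw [h, mul_eval_ratioPoly]
  refine Finset.sum_congr rfl fun j _ => ?_
  rw [eval_mul, eval_C, eval_map_algebraMap, aeval_pow_natCard_pow]

/-- For monic `a` of degree `d`, the polynomial `a - ∏ (t - θ ^ q ^ j)` has degree less than `d` and
the same values as `a` at the `d` nodes. -/
theorem aeval_eq_add_mul_eval_ratioPoly {θ : L} (hθ : Transcendental F θ) {d : ℕ} {a : F[X]}
    (ha : a ∈ monicsOfDegree F d) (t : L) :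
    aeval t a = ∏ j ∈ Finset.range d, (t - θ ^ Nat.card F ^ j) +
      aeval θ a * (ratioPoly F θ d t).eval (aeval θ a) := by
  obtain ⟨hm, hd⟩ := ha
  have hn := Lagrange.degree_nodal (s := Finset.range d) (v := fun j => θ ^ Nat.card F ^ j)
  have ha : (a.map (algebraMap F L)).degree = d := by
    rw [degree_map, degree_eq_natDegree hm.ne_zero, hd]
  have hlt := degree_sub_lt_left (p := a.map (algebraMap F L))
    (q := Lagrange.nodal (Finset.range d) fun j => θ ^ Nat.card F ^ j)
    (by rw [hn, ha, Finset.card_range]) (hm.map _).ne_zero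
    (by rw [Lagrange.nodal_monic.leadingCoeff, (hm.map _).leadingCoeff])
  have h := congrArg (eval t) (Lagrange.eq_interpolate (s := Finset.range d)
    (v := fun j => θ ^ Nat.card F ^ j) (pow_natCard_pow_injective hθ).injOn
    (by rwa [Finset.card_range, ← ha]))
  rw [eval_sub, eval_map_algebraMap, Lagrange.interpolate_apply, eval_finsetSum,
    Lagrange.eval_nodal, sub_eq_iff_eq_add'] at h
  rw [h, mul_eval_ratioPoly]
  congr 1
  refine Finset.sum_congr rfl fun j hj => ?_
  rw [eval_mul, eval_C, eval_sub, eval_map_algebraMap, aeval_pow_natCard_pow,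
    Lagrange.eval_nodal_at_node (v := fun j => θ ^ Nat.card F ^ j) hj, sub_zero]

/-! ### Sums over polynomials of bounded degree -/

/-- The finite set of polynomials of degree less than `d`. -/
def polysDegreeLT (F : Type*) [Field F] [Finite F] (d : ℕ) : Finset F[X] :=
  have : Finite (degreeLT F d) := Finite.of_equiv _ (degreeLTEquiv F d).toEquiv.symm
  (Set.toFinite (degreeLT F d : Set F[X])).toFinset

theorem mem_polysDegreeLT {F : Type*} [Field F] [Finite F] {d : ℕ} {a : F[X]} :
    a ∈ polysDegreeLT F d ↔ a.degree < d := by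
  simp [polysDegreeLT, mem_degreeLT]

theorem card_polysDegreeLT (F : Type*) [Field F] [Finite F] (d : ℕ) :
    (polysDegreeLT F d).card = Nat.card F ^ d := by
  have h := Nat.card_congr (degreeLTEquiv F d).toEquiv
  rw [Nat.card_fun, Nat.card_fin] at h
  rw [← h, polysDegreeLT, ← Set.ncard_eq_toFinset_card _ _, ← Nat.card_coe_set_eq]
  rfl

theorem card_monicsOfDegree (F : Type*) [Field F] [Finite F] (d : ℕ) :
    (monicsOfDegree_finite F d).toFinset.card = Nat.card F ^ d := by
  rw [← card_polysDegreeLT]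
  refine (Finset.card_nbij (X ^ d + ·) (fun a ha => ?_) (add_right_injective _).injOn
    fun b hb => ?_).symm
  · rw [Finset.mem_coe, mem_polysDegreeLT] at ha
    rw [Finset.mem_coe, Set.Finite.mem_toFinset]
    exact ⟨monic_X_pow_add ha, natDegree_eq_of_degree_eq_some
      ((degree_add_eq_left_of_degree_lt (by rwa [degree_X_pow])).trans (degree_X_pow d))⟩
  · obtain ⟨hm, hd⟩ := (monicsOfDegree_finite F d).mem_toFinset.1 hb
    refine ⟨b - X ^ d, ?_, add_sub_cancel _ _⟩
    rw [Finset.mem_coe, mem_polysDegreeLT]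
    have hb : b.degree = d := by rw [degree_eq_natDegree hm.ne_zero, hd]
    have := degree_sub_lt_left (q := X ^ d) (by rw [hb, degree_X_pow]) hm.ne_zero
      (by rw [hm.leadingCoeff, (monic_X_pow d).leadingCoeff])
    rwa [hb] at this

/-- Every nonzero polynomial is a constant times a monic one, and there are `q - 1 = -1` nonzero
constants. -/
theorem sum_polysDegreeLT_erase_zero [DecidableEq F[X]] (d : ℕ) (f : F[X] → L)
    (hf : ∀ c : F, c ≠ 0 → ∀ a, f (C c * a) = f a) :
    ∑ a ∈ (polysDegreeLT F d).erase 0, f a =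
      -∑ i ∈ Finset.range d, ∑ a ∈ (monicsOfDegree_finite F i).toFinset, f a := by
  classical
  cases nonempty_fintype F
  -- the number of nonzero constants, in `L`
  have hcard : (((Finset.univ : Finset F).erase 0).card : L) = -1 := by
    rw [Finset.card_erase_of_mem (Finset.mem_univ _), Finset.card_univ,
      Nat.cast_sub Fintype.card_pos, ← map_natCast (algebraMap F L), FiniteField.cast_card_eq_zero]
    simp
  have h : ∀ a, -f a = ∑ c ∈ (Finset.univ : Finset F).erase 0, f (C c * a) := fun a => by
    rw [Finset.sum_congr rfl fun c hc => hf c (Finset.ne_of_mem_erase hc) a, Finset.sum_const,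
      nsmul_eq_mul, hcard, neg_one_mul]
  rw [← Finset.sum_neg_distrib]
  simp_rw [← Finset.sum_neg_distrib, h]
  simp_rw [← Finset.sum_product']
  rw [Finset.sum_sigma']
  symm
  refine Finset.sum_nbij' (fun x => C x.2.2 * x.2.1)
    (fun a => ⟨a.natDegree, C a.leadingCoeff⁻¹ * a, a.leadingCoeff⟩) ?_ ?_ ?_ ?_ fun _ _ => rfl
  · rintro ⟨i, a, c⟩ hx
    simp only [Finset.mem_sigma, Finset.mem_range, Finset.mem_product, Set.Finite.mem_toFinset,
      Finset.mem_erase, Finset.mem_univ, and_true, mem_polysDegreeLT] at hx ⊢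
    obtain ⟨hi, ⟨hm, rfl⟩, hc⟩ := hx
    have : C c * a ≠ 0 := mul_ne_zero (C_ne_zero.2 hc) hm.ne_zero
    refine ⟨this, ?_⟩
    rwa [degree_C_mul hc, ← natDegree_lt_iff_degree_lt hm.ne_zero]
  · intro a ha
    simp only [Finset.mem_sigma, Finset.mem_range, Finset.mem_product, Set.Finite.mem_toFinset,
      Finset.mem_erase, Finset.mem_univ, and_true, mem_polysDegreeLT] at ha ⊢
    have hl : a.leadingCoeff ≠ 0 := leadingCoeff_ne_zero.2 ha.1
    refine ⟨(natDegree_lt_iff_degree_lt ha.1).2 ha.2, ⟨?_, ?_⟩, hl⟩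
    · exact monic_C_mul_of_mul_leadingCoeff_eq_one (inv_mul_cancel₀ hl)
    · exact natDegree_C_mul (inv_ne_zero hl)
  · rintro ⟨i, a, c⟩ hx
    simp only [Finset.mem_sigma, Finset.mem_range, Finset.mem_product, Set.Finite.mem_toFinset,
      Finset.mem_erase, Finset.mem_univ, and_true] at hx
    obtain ⟨hi, ⟨hm, rfl⟩, hc⟩ := hx
    have hl : (C c * a).leadingCoeff = c := by
      rw [leadingCoeff_mul, leadingCoeff_C, hm.leadingCoeff, mul_one]
    simp only [hl, natDegree_C_mul hc, ← mul_assoc, ← C_mul, inv_mul_cancel₀ hc, C_1, one_mul]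
  · intro a ha
    have hl : a.leadingCoeff ≠ 0 := leadingCoeff_ne_zero.2 (Finset.ne_of_mem_erase ha)
    simp only [← mul_assoc, ← C_mul, mul_inv_cancel₀ hl, C_1, one_mul]

/-- The product formula for sums over the monic polynomials of degree `d`, which form the level set
`E_d = 1`. The numerator is a polynomial in `a(θ)`, of degree less than `q ^ d` because there are
fewer than `q` factors, so that `sum_eval_aeval_div` applies to it. -/
theorem sum_monicsOfDegree_prod_aeval_div {ι : Type*} [Fintype ι] (hι : Fintype.card ι < Nat.card F)
    {θ : L} (hθ : Transcendental F θ) (t : ι → L) (d : ℕ) :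
    ∑ a ∈ (monicsOfDegree_finite F d).toFinset, (∏ i, aeval (t i) a) / aeval θ a =
      (∏ j ∈ Finset.range d, (θ - θ ^ Nat.card F ^ (j + 1)))⁻¹ *
        ∏ i, ∏ j ∈ Finset.range d, (t i - θ ^ Nat.card F ^ j) := by
  have hq : 0 < Nat.card F := Nat.card_pos
  let g : L[X] := ∏ i, (C (∏ j ∈ Finset.range d, (t i - θ ^ Nat.card F ^ j)) +
    X * ratioPoly F θ d (t i))
  have hg : g.natDegree < Nat.card F ^ d := by
    refine (natDegree_prod_le _ _).trans_lt ?_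
    rcases d with _ | d
    · simp [ratioPoly]
    · have hi : ∀ i ∈ Finset.univ, (C (∏ j ∈ Finset.range (d + 1), (t i - θ ^ Nat.card F ^ j)) +
          X * ratioPoly F θ (d + 1) (t i)).natDegree ≤ Nat.card F ^ d := fun i _ => by
        rw [natDegree_C_add]
        refine natDegree_mul_le.trans ?_
        have h := natDegree_ratioPoly_le (F := F) θ (d + 1) (t i)
        have : 0 < Nat.card F ^ d := pow_pos hq d
        rw [natDegree_X]
        simp only [Nat.add_sub_cancel] at h
        omega
      refine (Finset.sum_le_card_nsmul _ _ _ hi).trans_lt ?_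
      rw [smul_eq_mul, Finset.card_univ, pow_succ']
      exact Nat.mul_lt_mul_of_pos_right hι (pow_pos hq d)
  have hc : ∀ a ∈ (monicsOfDegree_finite F d).toFinset,
      (carlitzPoly F θ d).eval (aeval θ a) = 1 := fun a ha => by
    obtain ⟨hm, hd⟩ := (monicsOfDegree_finite F d).mem_toFinset.1 ha
    rw [eval_carlitzPoly_aeval hθ, ← hd, hm.coeff_natDegree, map_one]
    rw [degree_eq_natDegree hm.ne_zero, hd]
    exact Nat.cast_lt.2 d.lt_succ_self
  have h := sum_eval_aeval_div hθ (card_monicsOfDegree F d) hc hg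
  rw [frobeniusWeight_zero] at h
  convert h using 2
  · rename_i a ha
    rw [eval_prod]
    refine congrArg (· / _) (Finset.prod_congr rfl fun i _ => ?_)
    rw [aeval_eq_add_mul_eval_ratioPoly hθ ((monicsOfDegree_finite F d).mem_toFinset.1 ha),
      eval_add, eval_C, eval_mul, eval_X]
  · simp [g, eval_prod]

/-- The product formula for sums over the monic polynomials of degree at most `d`. The summand does
not change when `a` is multiplied by a constant, so the sum is minus the one over all nonzero `a` of
degree at most `d`. For `a ≠ 0` the summand is a polynomial in `a(θ)` of degree less than
`q ^ (d + 1) - 1`, whose sum over all `a` vanishes: what remains is its value at `a = 0`. -/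
theorem sum_range_sum_monicsOfDegree_prod_aeval_div {ι : Type*} [Fintype ι]
    (hι : Fintype.card ι ≤ Nat.card F) {θ : L} (hθ : Transcendental F θ) (t : ι → L) (d : ℕ) :
    ∑ i ∈ Finset.range (d + 1), ∑ a ∈ (monicsOfDegree_finite F i).toFinset,
        ∏ i, aeval (t i) a / aeval θ a =
      ∏ i, ∏ j ∈ Finset.range d,
        (t i - θ ^ Nat.card F ^ (j + 1)) / (θ - θ ^ Nat.card F ^ (j + 1)) := by
  classical
  have hq : 1 < Nat.card F := Finite.one_lt_card
  let g : L[X] := ∏ i, ratioPoly F θ (d + 1) (t i)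
  have hg : g.natDegree + 1 < Nat.card F ^ (d + 1) := by
    have h1 : g.natDegree ≤ Nat.card F * (Nat.card F ^ d - 1) := by
      refine (natDegree_prod_le _ _).trans ((Finset.sum_le_card_nsmul _ _ _ fun i _ =>
        natDegree_ratioPoly_le θ (d + 1) (t i)).trans ?_)
      rw [smul_eq_mul, Finset.card_univ, Nat.add_sub_cancel]
      exact Nat.mul_le_mul_right _ hι
    rw [Nat.mul_sub, mul_one, ← pow_succ'] at h1
    have h2 : Nat.card F ≤ Nat.card F ^ (d + 1) := Nat.le_self_pow d.succ_ne_zero _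
    omega
  have hc : ∀ a ∈ polysDegreeLT F (d + 1),
      (carlitzPoly F θ (d + 1)).eval (aeval θ a) = 0 := fun a ha => by
    rw [mem_polysDegreeLT] at ha
    rw [eval_carlitzPoly_aeval hθ, coeff_eq_zero_of_degree_lt ha, map_zero]
    exact ha.trans (Nat.cast_lt.2 (d + 1).lt_succ_self)
  have h := sum_eval_aeval_eq_zero hθ (card_polysDegreeLT F (d + 1)) hc hg
  -- the term of `a = 0` is separated from the others
  rw [← Finset.add_sum_erase _ _ (mem_polysDegreeLT.2 (by simp) : 0 ∈ polysDegreeLT F (d + 1)),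
    add_eq_zero_iff_eq_neg] at h
  have h' : ∀ a ∈ (polysDegreeLT F (d + 1)).erase 0, g.eval (aeval θ a) =
      ∏ i, aeval (t i) a / aeval θ a := fun a ha => by
    obtain ⟨ha0, ha⟩ := Finset.mem_erase.1 ha
    have hne : aeval θ a ≠ 0 :=
      (map_ne_zero_iff _ (transcendental_iff_injective.mp hθ)).2 ha0
    rw [eval_prod]
    refine Finset.prod_congr rfl fun i _ => ?_
    rw [aeval_eq_mul_eval_ratioPoly hθ (mem_polysDegreeLT.1 ha) (t i), mul_div_cancel_left₀ _ hne]
  rw [Finset.sum_congr rfl h', sum_polysDegreeLT_erase_zero, neg_neg, map_zero] at h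
  · rw [← h, eval_prod]
    exact Finset.prod_congr rfl fun i _ => eval_zero_ratioPoly θ d (t i)
  · intro c hc a
    refine Finset.prod_congr rfl fun i _ => ?_
    rw [map_mul, map_mul, aeval_C, aeval_C, mul_div_mul_left]
    exact (_root_.map_ne_zero (algebraMap F L)).2 hc

end ProductFormulas

end Polynomial

/-! ### Series in a complete field with a discrete valuation -/

section Valued

open WithZero

theorem Valued.nonarchimedeanAddGroup (K : Type*) [Field K] [hv : Valued K ℤᵐ⁰] :
    NonarchimedeanAddGroup K where
  is_nonarchimedean U hU := by
    obtain ⟨γ, hγ⟩ := Valued.mem_nhds_zero.1 hU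
    exact ⟨⟨Valuation.ltAddSubgroup hv.v.restrict γ, Valued.isOpen_ball K _⟩, hγ⟩

/-- Open balls are closed subgroups. -/
theorem Valued.tsum_lt {K : Type*} [Field K] [hv : Valued K ℤᵐ⁰] {f : ℕ → K} {y : K} (hy : y ≠ 0)
    (h : ∀ n, Valued.v (f n) < Valued.v y) : Valued.v (∑' n, f n) < Valued.v y := by
  have hne : hv.v.restrict y ≠ 0 := (Valuation.ne_zero_iff _).2 hy
  have h' : ∀ n, f n ∈ Valuation.ltAddSubgroup hv.v.restrict (Units.mk0 _ hne) := fun n =>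
    hv.v.restrict_lt_iff.2 (h n)
  have hc : IsClosed (Valuation.ltAddSubgroup hv.v.restrict (Units.mk0 _ hne) : Set K) :=
    Valued.isClosed_ball K _
  exact hv.v.restrict_lt_iff.1 (tsum_mem hc h')

theorem Valued.summable_of_valuation_succ_le {K : Type*} [Field K] [hv : Valued K ℤᵐ⁰]
    [CompleteSpace K] {f : ℕ → K} (h : ∀ n, Valued.v (f (n + 1)) ≤ exp (-1) * Valued.v (f n)) :
    Summable f := by
  have := Valued.nonarchimedeanAddGroup K
  refine NonarchimedeanAddGroup.summable_of_tendsto_cofinite_zero ?_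
  rw [Nat.cofinite_eq_atTop, (Valued.hasBasis_nhds_zero K ℤᵐ⁰).tendsto_right_iff]
  intro γ _
  have hn : ∀ n, Valued.v (f n) ≤ exp (-1) ^ n * Valued.v (f 0) := fun n => by
    induction n with
    | zero => simp
    | succ n ih =>
      rw [pow_succ', mul_assoc]
      exact (h n).trans (mul_le_mul_right ih _)
  have hlt : (exp (-1) : ℤᵐ⁰) < 1 := by
    rw [← exp_zero, exp_lt_exp]
    simp
  rw [Filter.eventually_atTop]
  set δ : ℤᵐ⁰ˣ :=
    Units.map (MonoidWithZeroHom.ValueGroup₀.embedding (f := (.ofClass hv.v))) γ with hδ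
  have key : ∃ N, ∀ n ≥ N, Valued.v (f n) < (δ : ℤᵐ⁰) := by
    by_cases h0 : f 0 = 0
    · refine ⟨0, fun n _ => (hn n).trans_lt ?_⟩
      rw [h0, map_zero, mul_zero]
      exact zero_lt_iff.2 δ.ne_zero
    · have hv0 : Valued.v (f 0) ≠ 0 := (Valuation.ne_zero_iff _).2 h0
      obtain ⟨N, hN⟩ := exists_pow_lt₀ hlt (δ / Units.mk0 _ hv0)
      refine ⟨N, fun n hNn => (hn n).trans_lt ?_⟩
      rw [Units.val_div_eq_div_val, Units.val_mk0, lt_div_iff₀ (zero_lt_iff.2 hv0)] at hN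
      exact lt_of_le_of_lt (mul_le_mul_left (pow_le_pow_right_of_le_one' hlt.le hNn) _) hN
  obtain ⟨N, hN⟩ := key
  exact ⟨N, fun n hNn => hv.v.restrict_lt_iff_lt_embedding.2 (hN n hNn)⟩

/-- The first term dominates all the others. -/
theorem Valued.tsum_ne_zero_of_valuation_succ_le {K : Type*} [Field K] [hv : Valued K ℤᵐ⁰]
    [CompleteSpace K] {f : ℕ → K} (h0 : f 0 ≠ 0)
    (h : ∀ n, Valued.v (f (n + 1)) ≤ exp (-1) * Valued.v (f n)) : ∑' n, f n ≠ 0 := by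
  have hv0 : Valued.v (f 0) ≠ 0 := (Valuation.ne_zero_iff _).2 h0
  have hlt : ∀ n, Valued.v (f (n + 1)) < Valued.v (f 0) := fun n => by
    have hone : (exp (-1) : ℤᵐ⁰) < 1 := by
      rw [← exp_zero, exp_lt_exp]
      simp
    induction n with
    | zero => exact (h 0).trans_lt (mul_lt_of_lt_one_left (zero_lt_iff.2 hv0) hone)
    | succ n ih => exact (h (n + 1)).trans_lt ((mul_le_of_le_one_left' hone.le).trans_lt ih)
  rw [(Valued.summable_of_valuation_succ_le h).tsum_eq_zero_add]
  intro h'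
  have h1 := Valued.tsum_lt h0 hlt
  rw [← neg_eq_of_add_eq_zero_right h', Valuation.map_neg] at h1
  exact h1.false

end Valued

theorem RatFunc.CompletionAtInfty.completeSpace (F : Type*) [Field F] [DecidableEq (RatFunc F)] :
    CompleteSpace (CompletionAtInfty F) :=
  letI := (inftyValued F).toUniformSpace
  inferInstanceAs (CompleteSpace (UniformSpace.Completion (RatFunc F)))

theorem RatFunc.CompletionAtInfty.valued_algebraMap (F : Type*) [Field F] [DecidableEq (RatFunc F)]
    (r : RatFunc F) :
    Valued.v (algebraMap (RatFunc F) (CompletionAtInfty F) r) = inftyValuation F r :=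
  let _ := inftyValued F
  Valued.extensionValuation_apply_coe r

/-! ### The terms of the depth-two multizeta series -/

section Terms

open WithZero

/-- Powers `a ^ q ^ j` of `a = a(t)` are the values `a(t ^ q ^ j)`. -/
theorem one_div_pow_sub_sum {F : Type*} [Field F] [Finite F] {ι : Type*} [Fintype ι] (k s : ℕ)
    (e : ι → ℕ) (he : ∑ i, Nat.card F ^ e i ≤ s * Nat.card F ^ k) {a : F[X]} (ha : a ≠ 0) :
    1 / algebraMap F[X] (RatFunc F) a ^ (s * Nat.card F ^ k - ∑ i, Nat.card F ^ e i) =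
      (∏ i, aeval ((RatFunc.X : RatFunc F) ^ Nat.card F ^ e i) a) /
        aeval ((RatFunc.X : RatFunc F) ^ Nat.card F ^ k) a ^ s := by
  have ha' : algebraMap F[X] (RatFunc F) a ≠ 0 := RatFunc.algebraMap_ne_zero ha
  simp_rw [aeval_pow_natCard_pow, RatFunc.aeval_X_left_eq_algebraMap, Finset.prod_pow_eq_pow_sum]
  rw [div_eq_div_iff (pow_ne_zero _ ha') (pow_ne_zero _ (pow_ne_zero _ ha')), one_mul, ← pow_mul,
    ← pow_add, add_comm, Nat.sub_add_cancel he, mul_comm]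

/-- Up to a factor that does not depend on `d`, the term of index `d + 1` of the series
`ζ(a, b)`, as a function of the list of all exponents of `q` subtracted in `a` and `b`; it is
invariant under permutations of this list. -/
def symmetricTerm (F : Type*) [Field F] (k s : ℕ) {ι : Type*} [Fintype ι] (e : ι → ℕ) (d : ℕ) :
    RatFunc F :=
  (∏ i, ∏ j ∈ Finset.range (d + 1),
      ((RatFunc.X : RatFunc F) ^ Nat.card F ^ e i - RatFunc.X ^ Nat.card F ^ (k + j))) /
    ((∏ j ∈ Finset.range (d + 1),
        ((RatFunc.X : RatFunc F) ^ Nat.card F ^ k - RatFunc.X ^ Nat.card F ^ (k + (j + 1)))) *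
      (∏ j ∈ Finset.range d,
        ((RatFunc.X : RatFunc F) ^ Nat.card F ^ k - RatFunc.X ^ Nat.card F ^ (k + (j + 1)))) ^ s)

theorem symmetricTerm_comp_equiv (F : Type*) [Field F] (k s : ℕ) {ι : Type*} [Fintype ι]
    (e : ι → ℕ) (σ : Equiv.Perm ι) (d : ℕ) :
    symmetricTerm F k s (e ∘ σ) d = symmetricTerm F k s e d := by
  rw [symmetricTerm, symmetricTerm]
  congr 1
  exact Equiv.prod_comp σ fun i => ∏ j ∈ Finset.range (d + 1),
    ((RatFunc.X : RatFunc F) ^ Nat.card F ^ e i - RatFunc.X ^ Nat.card F ^ (k + j))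

/-- Both product formulas, at `θ = X ^ q ^ k` and evaluation points `X ^ q ^ κ i`, `X ^ q ^ l j`.
The only asymmetry between the two is the factor `j = 0` of `∏ (t - θ ^ q ^ j)`, which is missing from
the second. -/
theorem iteratedPowerSum_mul_prod {F : Type*} [Field F] [Finite F] {k s₁ s₂ : ℕ}
    (hs₁ : s₁ < Nat.card F) (hs₂ : s₂ ≤ Nat.card F) (κ : Fin s₁ → ℕ) (l : Fin s₂ → ℕ)
    (hκ : ∑ i, Nat.card F ^ κ i ≤ Nat.card F ^ k)
    (hl : ∑ j, Nat.card F ^ l j ≤ s₂ * Nat.card F ^ k) (d : ℕ) :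
    iteratedPowerSum F (d + 1) (Nat.card F ^ k - ∑ i, Nat.card F ^ κ i)
        (s₂ * Nat.card F ^ k - ∑ j, Nat.card F ^ l j) *
      ∏ j, ((RatFunc.X : RatFunc F) ^ Nat.card F ^ l j - RatFunc.X ^ Nat.card F ^ k) =
    symmetricTerm F k s₂ (Sum.elim κ l) d := by
  have hθ : Transcendental F ((RatFunc.X : RatFunc F) ^ Nat.card F ^ k) :=
    RatFunc.transcendental_X.pow (pow_pos Nat.card_pos k)
  have h1 : powerSum F (d + 1) (Nat.card F ^ k - ∑ i, Nat.card F ^ κ i) = _ :=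
    Eq.trans (Finset.sum_congr rfl fun a ha => by
      have h := one_div_pow_sub_sum k 1 κ (by rwa [one_mul])
        ((monicsOfDegree_finite F (d + 1)).mem_toFinset.1 ha).1.ne_zero
      rwa [one_mul, pow_one] at h)
      (sum_monicsOfDegree_prod_aeval_div (by rwa [Fintype.card_fin]) hθ
        (fun i => (RatFunc.X : RatFunc F) ^ Nat.card F ^ κ i) (d + 1))
  have h2 : powerSumLT F (d + 1) (s₂ * Nat.card F ^ k - ∑ j, Nat.card F ^ l j) = _ :=
    Eq.trans (Finset.sum_congr rfl fun i _ => Finset.sum_congr rfl fun a ha => by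
      rw [one_div_pow_sub_sum k s₂ l hl ((monicsOfDegree_finite F i).mem_toFinset.1 ha).1.ne_zero,
        Finset.prod_div_distrib, Finset.prod_const, Finset.card_univ, Fintype.card_fin])
      (sum_range_sum_monicsOfDegree_prod_aeval_div (by rwa [Fintype.card_fin]) hθ
        (fun i => (RatFunc.X : RatFunc F) ^ Nat.card F ^ l i) d)
  rw [iteratedPowerSum, h1, h2, symmetricTerm, Fintype.prod_sum_type]
  simp_rw [← pow_mul, ← pow_add, Finset.prod_div_distrib, Sum.elim_inl, Sum.elim_inr]
  rw [Finset.prod_const, Finset.card_univ, Fintype.card_fin]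
  simp_rw [Finset.prod_range_succ' _ d, add_zero]
  rw [Finset.prod_mul_distrib (s := Finset.univ) (f := fun i : Fin s₂ => _)]
  simp only [div_eq_mul_inv, mul_inv]
  ring

end Terms

/-! ### Absolute values of the terms -/

section Valuation

open WithZero

theorem inftyValuation_X_pow_sub_X_pow {F : Type*} [Field F] [DecidableEq (RatFunc F)] {m n : ℕ}
    (h : m < n) : inftyValuation F ((RatFunc.X : RatFunc F) ^ m - RatFunc.X ^ n) = exp (n : ℤ) := by
  have hv : ∀ n : ℕ, inftyValuation F ((RatFunc.X : RatFunc F) ^ n) = exp (n : ℤ) := fun n => by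
    rw [map_pow, inftyValuation.X, ← exp_nsmul, nsmul_eq_mul, mul_one]
  rw [Valuation.map_sub_eq_of_lt_right, hv]
  rw [hv, hv, exp_lt_exp]
  exact_mod_cast h

theorem X_pow_sub_X_pow_ne_zero {F : Type*} [Field F] {m n : ℕ} (h : m ≠ n) :
    (RatFunc.X : RatFunc F) ^ m - RatFunc.X ^ n ≠ 0 := by
  classical
  wlog hlt : m < n generalizing m n
  · rw [← neg_sub, neg_ne_zero]
    exact this h.symm (by omega)
  rw [← (inftyValuation F).ne_zero_iff, inftyValuation_X_pow_sub_X_pow hlt]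
  exact exp_ne_zero

theorem natCard_pow_lt {F : Type*} [Field F] [Finite F] {m n : ℕ} (h : m < n) :
    Nat.card F ^ m < Nat.card F ^ n :=
  Nat.pow_lt_pow_right Finite.one_lt_card h

theorem symmetricTerm_ne_zero {F : Type*} [Field F] [Finite F] {k s : ℕ} {ι : Type*} [Fintype ι]
    {e : ι → ℕ} (he : ∀ i, e i < k) (d : ℕ) : symmetricTerm F k s e d ≠ 0 := by
  have h : ∀ n : ℕ, ∏ j ∈ Finset.range n,
      ((RatFunc.X : RatFunc F) ^ Nat.card F ^ k - RatFunc.X ^ Nat.card F ^ (k + (j + 1))) ≠ 0 :=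
    fun n => Finset.prod_ne_zero_iff.2 fun j _ =>
      X_pow_sub_X_pow_ne_zero (natCard_pow_lt (by omega)).ne
  refine div_ne_zero (Finset.prod_ne_zero_iff.2 fun i _ => Finset.prod_ne_zero_iff.2 fun j _ => ?_)
    (mul_ne_zero (h _) (pow_ne_zero _ (h _)))
  exact X_pow_sub_X_pow_ne_zero (natCard_pow_lt ((he i).trans_le (by omega))).ne

/-- Passing from index `d` to `d + 1` multiplies the absolute value by the exponential of
`(s + s') q ^ (k + d + 1) - q ^ (k + d + 2) - s q ^ (k + d + 1) = (s' - q) q ^ (k + d + 1)`, where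
`s + s'` is the number of exponents; this is negative for `s' < q`. -/
theorem inftyValuation_symmetricTerm_succ_le {F : Type*} [Field F] [Finite F]
    [DecidableEq (RatFunc F)] {k s : ℕ} {ι : Type*} [Fintype ι]
    (hι : Fintype.card ι < s + Nat.card F)
    {e : ι → ℕ} (he : ∀ i, e i < k) (d : ℕ) :
    inftyValuation F (symmetricTerm F k s e (d + 1)) ≤
      exp (-1) * inftyValuation F (symmetricTerm F k s e d) := by
  have hsucc : symmetricTerm F k s e (d + 1) =
      (∏ i, ((RatFunc.X : RatFunc F) ^ Nat.card F ^ e i - RatFunc.X ^ Nat.card F ^ (k + (d + 1)))) /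
        ((RatFunc.X ^ Nat.card F ^ k - RatFunc.X ^ Nat.card F ^ (k + (d + 2))) *
          (RatFunc.X ^ Nat.card F ^ k - RatFunc.X ^ Nat.card F ^ (k + (d + 1))) ^ s) *
        symmetricTerm F k s e d := by
    rw [symmetricTerm, symmetricTerm]
    simp_rw [Finset.prod_range_succ _ (d + 1)]
    rw [Finset.prod_range_succ _ d, Finset.prod_mul_distrib]
    simp only [div_eq_mul_inv, mul_inv, mul_pow]
    ring
  rw [hsucc, map_mul]
  refine mul_le_mul_left ?_ _
  rw [map_div₀, map_mul, map_pow, map_prod,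
    inftyValuation_X_pow_sub_X_pow (natCard_pow_lt (by omega)),
    inftyValuation_X_pow_sub_X_pow (natCard_pow_lt (by omega)),
    Finset.prod_congr rfl fun i _ =>
      inftyValuation_X_pow_sub_X_pow (natCard_pow_lt ((he i).trans_le (by omega))),
    Finset.prod_const, Finset.card_univ, ← exp_nsmul, ← exp_nsmul, ← exp_add, ← exp_sub, exp_le_exp]
  have h1 : (Fintype.card ι : ℤ) + 1 ≤ s + Nat.card F := by exact_mod_cast hι
  have h2 : (1 : ℤ) ≤ (Nat.card F ^ (k + (d + 1)) : ℕ) := by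
    exact_mod_cast Nat.pos_of_ne_zero (pow_ne_zero _ Nat.card_pos.ne')
  have h3 : ((Nat.card F ^ (k + (d + 2)) : ℕ) : ℤ) =
      Nat.card F * (Nat.card F ^ (k + (d + 1)) : ℕ) := by
    rw [show k + (d + 2) = k + (d + 1) + 1 by ring, pow_succ']
    push_cast
    ring
  rw [h3, nsmul_eq_mul, nsmul_eq_mul]
  nlinarith [mul_nonneg (sub_nonneg.2 h1) (zero_le_one.trans h2)]

end Valuation

/-! ### The multizeta values -/

theorem multizetaTerm_zero (F : Type*) [Field F] [Finite F] [DecidableEq (RatFunc F)] (a b : ℕ) :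
    multizetaTerm F a b 0 = 0 := by
  simp [multizetaTerm, iteratedPowerSum, powerSumLT]

theorem sum_natCard_pow_le {F : Type*} [Field F] [Finite F] {k s : ℕ} {e : Fin s → ℕ}
    (he : ∀ i, e i < k) : ∑ i, Nat.card F ^ e i ≤ s * Nat.card F ^ k := by
  refine (Finset.sum_le_card_nsmul _ _ _ fun i _ => (natCard_pow_lt (he i)).le).trans_eq ?_
  rw [smul_eq_mul, Finset.card_univ, Fintype.card_fin]

theorem sum_natCard_pow_le_pow {F : Type*} [Field F] [Finite F] {k s : ℕ} (hs : s ≤ Nat.card F)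
    (hk : 0 < k) {e : Fin s → ℕ} (he : ∀ i, e i < k) :
    ∑ i, Nat.card F ^ e i ≤ Nat.card F ^ k := by
  obtain ⟨k, rfl⟩ := Nat.exists_eq_succ_of_ne_zero hk.ne'
  refine (Finset.sum_le_card_nsmul _ _ _ fun i _ =>
    Nat.pow_le_pow_right Nat.card_pos (Nat.le_of_lt_succ (he i))).trans ?_
  rw [smul_eq_mul, Finset.card_univ, Fintype.card_fin, Nat.succ_eq_add_one, pow_succ']
  exact Nat.mul_le_mul_right _ hs

theorem multizetaTerm_eq {F : Type*} [Field F] [Finite F] [DecidableEq (RatFunc F)] {k s₁ s₂ : ℕ}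
    (hk : 0 < k) (hs₁ : s₁ < Nat.card F) (hs₂ : s₂ ≤ Nat.card F) {κ : Fin s₁ → ℕ} {l : Fin s₂ → ℕ}
    (hκ : ∀ i, κ i < k) (hl : ∀ j, l j < k) (d : ℕ) :
    multizetaTerm F (Nat.card F ^ k - ∑ i, Nat.card F ^ κ i)
        (s₂ * Nat.card F ^ k - ∑ j, Nat.card F ^ l j) (d + 1) =
      algebraMap (RatFunc F) (CompletionAtInfty F) (symmetricTerm F k s₂ (Sum.elim κ l) d) *
        algebraMap (RatFunc F) (CompletionAtInfty F)
          (∏ j, ((RatFunc.X : RatFunc F) ^ Nat.card F ^ l j - RatFunc.X ^ Nat.card F ^ k))⁻¹ := by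
  rw [multizetaTerm, ← map_mul, ← iteratedPowerSum_mul_prod hs₁ hs₂ κ l
    (sum_natCard_pow_le_pow hs₁.le hk hκ) (sum_natCard_pow_le hl), mul_inv_cancel_right₀]
  exact Finset.prod_ne_zero_iff.2 fun j _ => X_pow_sub_X_pow_ne_zero (natCard_pow_lt (hl j)).ne

/-- Both assertions follow from `multizetaTerm_eq`, as the term of index `0` vanishes. -/
theorem summable_multizetaTerm_and_multizeta_eq {F : Type*} [Field F] [Finite F]
    [DecidableEq (RatFunc F)] {k s₁ s₂ : ℕ}
    (hk : 0 < k) (hs₁ : s₁ < Nat.card F) (hs₂ : s₂ ≤ Nat.card F) {κ : Fin s₁ → ℕ} {l : Fin s₂ → ℕ}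
    (hκ : ∀ i, κ i < k) (hl : ∀ j, l j < k)
    (hsum : Summable fun d => algebraMap (RatFunc F) (CompletionAtInfty F)
      (symmetricTerm F k s₂ (Sum.elim κ l) d)) :
    Summable (multizetaTerm F (Nat.card F ^ k - ∑ i, Nat.card F ^ κ i)
        (s₂ * Nat.card F ^ k - ∑ j, Nat.card F ^ l j)) ∧
      multizeta F (Nat.card F ^ k - ∑ i, Nat.card F ^ κ i)
          (s₂ * Nat.card F ^ k - ∑ j, Nat.card F ^ l j) =
        (∑' d, algebraMap (RatFunc F) (CompletionAtInfty F)
            (symmetricTerm F k s₂ (Sum.elim κ l) d)) *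
          algebraMap (RatFunc F) (CompletionAtInfty F)
            (∏ j, ((RatFunc.X : RatFunc F) ^ Nat.card F ^ l j - RatFunc.X ^ Nat.card F ^ k))⁻¹ := by
  have h := hsum.mul_right (algebraMap (RatFunc F) (CompletionAtInfty F)
    (∏ j, ((RatFunc.X : RatFunc F) ^ Nat.card F ^ l j - RatFunc.X ^ Nat.card F ^ k))⁻¹)
  simp_rw [← multizetaTerm_eq hk hs₁ hs₂ hκ hl] at h
  have hT := (summable_nat_add_iff 1).1 h
  refine ⟨hT, ?_⟩
  rw [multizeta, hT.tsum_eq_zero_add, multizetaTerm_zero, zero_add, ← tsum_mul_right]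
  exact tsum_congr fun d => multizetaTerm_eq hk hs₁ hs₂ hκ hl d

theorem theorem2 (F : Type*) [Field F] [Finite F] [DecidableEq (RatFunc F)]
    (q : ℕ) (hq : Nat.card F = q)
    (k s₁ s₂ : ℕ) (hs₁ : 1 ≤ s₁) (hs₁q : s₁ < q) (hs₂ : 1 ≤ s₂) (hs₂q : s₂ ≤ q)
    (κ : Fin s₁ → ℕ) (hκ : ∀ i, κ i < k)
    (l : Fin s₂ → ℕ) (hl : ∀ j, l j < k)
    (κ' : Fin s₁ → ℕ) (l' : Fin s₂ → ℕ)
    -- `κ'` is a choice of `s₁` entries of the list `κ, l` (by position), `l'` the remaining ones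
    (σ : Equiv.Perm (Fin s₁ ⊕ Fin s₂))
    (hκ' : ∀ i, κ' i = Sum.elim κ l (σ (Sum.inl i)))
    (hl' : ∀ j, l' j = Sum.elim κ l (σ (Sum.inr j)))
    -- none of the following subtractions of natural numbers truncates
    (a b a' b' : ℕ)
    (ha : a = q ^ k - ∑ i, q ^ κ i) (hb : b = s₂ * q ^ k - ∑ j, q ^ l j)
    (ha' : a' = q ^ k - ∑ i, q ^ κ' i) (hb' : b' = s₂ * q ^ k - ∑ j, q ^ l' j) :
    Summable (multizetaTerm F a b) ∧ Summable (multizetaTerm F a' b') ∧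
    multizeta F a' b' ≠ 0 ∧
    ∃ r : RatFunc F,
      multizeta F a b / multizeta F a' b' = algebraMap (RatFunc F) (CompletionAtInfty F) r := by
  subst hq ha hb ha' hb'
  have := CompletionAtInfty.completeSpace F
  have hk : 0 < k := (Nat.zero_le _).trans_lt (hκ ⟨0, hs₁⟩)
  have hkl : ∀ x, Sum.elim κ l x < k := fun x => by
    cases x with
    | inl i => exact hκ i
    | inr j => exact hl j
  have hkl' : Sum.elim κ' l' = Sum.elim κ l ∘ σ := funext fun x => by
    cases x with
    | inl i => exact hκ' i
    | inr j => exact hl' j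
  -- by the permutation invariance, `u` serves both multizeta values
  set u : ℕ → CompletionAtInfty F := fun d =>
    algebraMap (RatFunc F) (CompletionAtInfty F) (symmetricTerm F k s₂ (Sum.elim κ l) d) with hu
  have hu0 : u 0 ≠ 0 := (_root_.map_ne_zero _).2 (symmetricTerm_ne_zero hkl 0)
  have hu1 : ∀ d, Valued.v (u (d + 1)) ≤ WithZero.exp (-1) * Valued.v (u d) := fun d => by
    rw [hu, CompletionAtInfty.valued_algebraMap, CompletionAtInfty.valued_algebraMap]
    refine inftyValuation_symmetricTerm_succ_le ?_ hkl d
    rw [Fintype.card_sum, Fintype.card_fin, Fintype.card_fin, add_comm]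
    exact Nat.add_lt_add_left hs₁q _
  have hsum := Valued.summable_of_valuation_succ_le hu1
  have hne := Valued.tsum_ne_zero_of_valuation_succ_le hu0 hu1
  have hu' : u = fun d => algebraMap (RatFunc F) (CompletionAtInfty F)
      (symmetricTerm F k s₂ (Sum.elim κ' l') d) := by
    simp_rw [hu, hkl', symmetricTerm_comp_equiv]
  obtain ⟨hT, hζ⟩ := summable_multizetaTerm_and_multizeta_eq hk hs₁q hs₂q hκ hl hsum
  obtain ⟨hT', hζ'⟩ := summable_multizetaTerm_and_multizeta_eq hk hs₁q hs₂q (κ := κ') (l := l')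
    (fun i => hκ' i ▸ hkl _) (fun j => hl' j ▸ hkl _) (hu' ▸ hsum)
  rw [← hu'] at hζ'
  refine ⟨hT, hT', ?_,
    (∏ j, ((RatFunc.X : RatFunc F) ^ Nat.card F ^ l j - RatFunc.X ^ Nat.card F ^ k))⁻¹ /
      (∏ j, ((RatFunc.X : RatFunc F) ^ Nat.card F ^ l' j - RatFunc.X ^ Nat.card F ^ k))⁻¹, ?_⟩
  · rw [hζ']
    refine mul_ne_zero hne ((_root_.map_ne_zero _).2 (inv_ne_zero ?_))
    exact Finset.prod_ne_zero_iff.2 fun j _ =>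
      X_pow_sub_X_pow_ne_zero (natCard_pow_lt (hl' j ▸ hkl _)).ne
  · rw [hζ, hζ', mul_div_mul_left _ _ hne, ← map_div₀]

end
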